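/- For positive integers $r\le m$ let $U(m,r)$ be the graph whose vertices are the pairs $(i,A)$ with $i\in[m]=\{1,\dots,m\}$, $A\subseteq[m]$, $|A|=r-1$, $i\notin A$, where $(i,A)$ and $(j,B)$ are adjacent if and only if $i\in B$ and $j\in A$. For a finite graph $G$ the box complex $B_0(G)$ is the simplicial complex on the vertex set $V(G)\times\{1,2\}$ whose simplices are the nonempty sets $S\times\{1\}\cup T\times\{2\}$ with $S,T\subseteq V(G)$, $S\cap T=\emptyset$, such that every vertex of $S$ is adjacent in $G$ to every vertex of $T$. Its body (geometric realization) $\|B_0(G)\|$ carries the involution induced by exchanging $(v,1)$ and $(v,2)$ for all $v\in V(G)$. For a topological space $T$ with a continuous involution $\nu$, the coindex ${\rm coind}(T)$ is the largest $d\ge0$ for which there is a continuous map $f:\mathbb S^d\to T$ with $f(-x)=\nu(f(x))$ for all $x\in\mathbb S^d$ (and $\infty$ if such maps exist for all $d$). The graph $G$ is called topologically $t$-chromatic if ${\rm coind}(\|B_0(G)\|)\ge t-1$. Corollary. For every integer $r\ge1$ the graph $U(2r-1,r)$ is topologically $(2r-2)$-chromatic. Moreover, for every integer $r\ge2$, $${\rm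 coind}(\|B_0(U(2r-1,r))\|)=2r-3.$$ -/

import Mathlib

universe u v

/-- A `ℤ₂`-space (involution space): a topological space with a continuous involution. -/
structure Z2Space where
  carrier : Type u
  [top : TopologicalSpace carrier]
  inv : carrier → carrier
  continuous_inv : Continuous inv
  involutive_inv : Function.Involutive inv

namespace Z2Space

instance (T : Z2Space.{u}) : TopologicalSpace T.carrier := T.top

/-- `S → T`: there is a continuous equivariant map (a `ℤ₂`-map) from `S` to `T`. -/
def HasMap (S : Z2Space.{u}) (T : Z2Space.{v}) : Prop :=
  ∃ f : S.carrier → T.carrier, Continuous f ∧ ∀ x, f (S.inv x) = T.inv (f x)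

/-- The unit sphere `𝕊^d` of `ℝ^(d+1)` with the antipodal involution `x ↦ -x`. -/
noncomputable def sphere (d : ℕ) : Z2Space.{0} where
  carrier := Metric.sphere (0 : EuclideanSpace ℝ (Fin (d + 1))) 1
  inv := fun x => -x
  continuous_inv := continuous_neg
  involutive_inv := neg_neg

/-- The `ℤ₂`-coindex: the largest `d ≥ 0` with `𝕊^d → T`, equal to `⊤` (that is, `∞`) if there
is no bound on such `d`, and to `⊥` if there is no such `d` (which happens only for the empty
space). -/
noncomputable def coind (T : Z2Space.{u}) : WithBot ℕ∞ :=
  ⨆ d : {d : ℕ // HasMap (sphere d) T}, ((d : ℕ) : WithBot ℕ∞)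

end Z2Space

/-- The body `‖K‖` of a simplicial complex on a finite vertex set `ι`: the points of `ℝ^ι`
that are convex combinations of the basis vectors and whose support is a simplex of `K`. -/
def AbstractSimplicialComplex.body {ι : Type u} [Fintype ι]
    (K : AbstractSimplicialComplex ι) : Set (ι → ℝ) :=
  {a | a ∈ stdSimplex ℝ ι ∧ ∃ s ∈ K.faces, ∀ x, x ∈ s ↔ 0 < a x}

namespace SimpleGraph

variable {V : Type u}

/-- The set `S` for a set of signed vertices `S ⊎ T`; `(v, true)` stands for `+v`. -/
def plusPart (s : Finset (V × Bool)) : Set V := {v | (v, true) ∈ s}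

/-- The set `T` for a set of signed vertices `S ⊎ T`; `(v, false)` stands for `-v`. -/
def minusPart (s : Finset (V × Bool)) : Set V := {v | (v, false) ∈ s}

/-- The box complex `B₀(G)`: a nonempty `S ⊎ T` is a simplex iff `S` and `T` are disjoint and the
complete bipartite graph with sides `S` and `T` is a subgraph of `G`. -/
def boxComplex (G : SimpleGraph V) : AbstractSimplicialComplex (V × Bool) where
  faces := {s | s.Nonempty ∧ Disjoint (plusPart s) (minusPart s) ∧
    ∀ v ∈ plusPart s, ∀ w ∈ minusPart s, G.Adj v w}
  isRelLowerSet_faces := by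
    rintro s ⟨hs, hd, ha⟩
    refine ⟨hs, fun t hts ht => ⟨ht, ?_, fun v hv w hw => ha v (hts hv) w (hts hw)⟩⟩
    exact hd.mono (fun v hv => hts hv) (fun v hv => hts hv)
  singleton_mem := by
    rintro ⟨v, b⟩
    refine ⟨Finset.singleton_nonempty _, ?_, ?_⟩
    · rw [Set.disjoint_left]
      intro w hw hw'
      simp only [plusPart, minusPart, Set.mem_ofPred_eq, Finset.mem_singleton,
        Prod.mk.injEq] at hw hw'
      exact absurd (hw.2.trans hw'.2.symm) (by decide)
    · intro w hw w' hw'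
      simp only [plusPart, minusPart, Set.mem_ofPred_eq, Finset.mem_singleton,
        Prod.mk.injEq] at hw hw'
      exact absurd (hw.2.trans hw'.2.symm) (by decide)

/-- Switching the signs: the simplicial involution of `B₀(G)` exchanging `+v` and `-v`. -/
def signSwap : V × Bool → V × Bool := fun x => (x.1, !x.2)

theorem signSwap_signSwap (x : V × Bool) : signSwap (signSwap x) = x := by
  simp [signSwap]

theorem boxComplex_swap_mem [DecidableEq V] (G : SimpleGraph V) {s : Finset (V × Bool)}
    (hs : s ∈ G.boxComplex.faces) : s.image signSwap ∈ G.boxComplex.faces := by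
  obtain ⟨hn, hd, ha⟩ := hs
  have hp : plusPart (s.image signSwap) = minusPart s := by
    ext v; simp [plusPart, minusPart, signSwap]
  have hm : minusPart (s.image signSwap) = plusPart s := by
    ext v; simp [plusPart, minusPart, signSwap]
  refine ⟨hn.image _, ?_, ?_⟩
  · rw [hp, hm]; exact hd.symm
  · rw [hp, hm]; exact fun v hv w hw => (ha w hw v hv).symm

theorem body_boxComplex_swap [Fintype V] (G : SimpleGraph V) {a : V × Bool → ℝ}
    (ha : a ∈ G.boxComplex.body) : (fun x => a (signSwap x)) ∈ G.boxComplex.body := by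
  classical
  obtain ⟨⟨h0, h1⟩, s, hs, hsa⟩ := ha
  refine ⟨⟨fun x => h0 _, ?_⟩, s.image signSwap, G.boxComplex_swap_mem hs, fun x => ?_⟩
  · rw [← h1]
    exact Fintype.sum_equiv ⟨signSwap, signSwap, signSwap_signSwap, signSwap_signSwap⟩ _ _
      (fun x => rfl)
  · rw [← hsa, Finset.mem_image]
    constructor
    · rintro ⟨y, hy, rfl⟩
      rwa [signSwap_signSwap]
    · exact fun h => ⟨_, h, signSwap_signSwap x⟩

/-- `‖B₀(G)‖` as a `ℤ₂`-space, with the involution induced by exchanging `+v` and `-v`. -/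
noncomputable def boxSpace [Fintype V] (G : SimpleGraph V) : Z2Space.{u} where
  carrier := G.boxComplex.body
  inv := fun a => ⟨fun x => a.1 (signSwap x), G.body_boxComplex_swap a.2⟩
  continuous_inv := by
    refine Continuous.subtype_mk (continuous_pi fun x => ?_) _
    exact (continuous_apply (signSwap x)).comp continuous_subtype_val
  involutive_inv := by
    intro a
    ext x
    simp [signSwap_signSwap]

/-- `G` is topologically `t`-chromatic: `coind ‖B₀(G)‖ ≥ t - 1`. -/
def IsTopologicallyChromatic [Fintype V] (G : SimpleGraph V) (t : ℕ) : Prop :=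
  (t : WithBot ℕ∞) ≤ G.boxSpace.coind + 1

/-- The vertices of `U(m, r)`: pairs `(i, A)` with `i ∈ [m]`, `A ⊆ [m]`, `|A| = r - 1` and
`i ∉ A`. Here `Fin m` stands for `[m]`. -/
abbrev UVertex (m r : ℕ) : Type :=
  {p : Fin m × Finset (Fin m) // p.2.card + 1 = r ∧ p.1 ∉ p.2}

/-- The graph `U(m, r)`: `(i, A)` and `(j, B)` are adjacent iff `i ∈ B` and `j ∈ A`. -/
def universalGraph (m r : ℕ) : SimpleGraph (UVertex m r) where
  Adj p q := p.1.1 ∈ q.1.2 ∧ q.1.1 ∈ p.1.2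
  symm := ⟨fun _ _ h => ⟨h.2, h.1⟩⟩
  loopless := ⟨fun p h => p.2.2 h.1⟩

end SimpleGraph

/-! Put m = 2r - 1 with r ≥ 2. Lower bound: append a coordinate 0 to x ∈ 𝕊^(2r-3) and subtract the
median. The resulting y ∈ ℝ^m is odd in x, never zero, and has at most r - 1 negative and at most r
- 1 positive coordinates. So if y i is large, some (r - 1)-set A avoids i and contains all very
negative coordinates. Weights on such pairs (i, A) for y, with sign +, and on the pairs (j, B) for
-y, with sign -, give a point of the box complex: i is very negative for -y and j for y, so i ∈ B
and j ∈ A.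

Upper bound: summing signed weights over all vertices with the same first component gives an odd map
‖B₀‖ → ℝ^m without zeros, and a value with a negative coordinate has at most r - 1 positive ones.
Hence it misses the line spanned by a vector with r entries 1 and r - 1 entries -1. Modulo this line
it is an odd nowhere zero map to ℝ^(2r-2), so `borsuk_ulam` excludes spheres of dimension at least
2r - 2.

Borsuk–Ulam follows from Fan's parity argument, with mod 2 cochains on lists of points in place of
triangulations. A hemisphere of dimension d + 1 is the cone, subdivided in N steps, over a
d-hemisphere and its antipode. By `hemisphere_coboundary` and `coboundary_fanCochain`, the
coboundary of the alternating-simplex cochain takes the value 1 on hemispheres of every dimension;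
with too few labels it would be 0. -/

namespace ListCochain

/-! ### Mod 2 cochains on lists and the prism homotopy. -/

variable {X Y : Type*}

/-- The mod 2 coboundary of a cochain on lists: the sum of its values over all lists obtained by
deleting one entry. -/
def coboundary : (List X → ZMod 2) → List X → ZMod 2
  | _, [] => 0
  | φ, a :: l => φ l + coboundary (fun l' => φ (a :: l')) l

/-- The prism operator of a pair of maps, on mod 2 cochains. -/
def prism (f g : X → Y) : (List Y → ZMod 2) → List X → ZMod 2
  | _, [] => 0
  | φ, a :: l => φ (f a :: g a :: l.map g) + prism f g (fun l' => φ (f a :: l')) l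

theorem coboundary_add (φ ψ : List X → ZMod 2) (l : List X) :
    coboundary (fun l => φ l + ψ l) l = coboundary φ l + coboundary ψ l := by
  induction l generalizing φ ψ with
  | nil => simp [coboundary]
  | cons a l ih => simp only [coboundary, ih]; ring

theorem coboundary_zero (l : List X) : coboundary (fun _ => 0) l = 0 := by
  induction l with
  | nil => rfl
  | cons a l ih => simp [coboundary, ih]

theorem coboundary_sum {ι : Type*} (s : Finset ι) (φ : ι → List X → ZMod 2) (l : List X) :
    coboundary (fun l => ∑ i ∈ s, φ i l) l = ∑ i ∈ s, coboundary (φ i) l := by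
  classical
  induction s using Finset.induction_on with
  | empty => simp [coboundary_zero]
  | insert i s hi ih => simp only [Finset.sum_insert hi, coboundary_add, ih]

theorem coboundary_map (f : X → Y) (φ : List Y → ZMod 2) (l : List X) :
    coboundary (fun l => φ (l.map f)) l = coboundary φ (l.map f) := by
  induction l generalizing φ with
  | nil => rfl
  | cons a l ih =>
    simp only [coboundary, List.map_cons]
    rw [ih fun l' => φ (f a :: l')]

theorem coboundary_congr {φ ψ : List X → ZMod 2} {l : List X}
    (h : ∀ l', l'.Sublist l → φ l' = ψ l') : coboundary φ l = coboundary ψ l := by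
  induction l generalizing φ ψ with
  | nil => rfl
  | cons a l ih =>
    simp only [coboundary]
    rw [h l (List.sublist_cons_self a l), ih fun l' hl' => h _ (hl'.cons_cons a)]

theorem coboundary_perm {φ : List X → ZMod 2} (hφ : ∀ l l', l.Perm l' → φ l = φ l')
    {l l' : List X} (h : l.Perm l') : coboundary φ l = coboundary φ l' := by
  induction h generalizing φ with
  | nil => rfl
  | cons a h ih =>
    simp only [coboundary]
    rw [hφ _ _ h, ih fun _ _ h => hφ _ _ (h.cons a)]
  | swap a b l =>
    have : (fun l' => φ (b :: a :: l')) = fun l' => φ (a :: b :: l') :=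
      funext fun l' => hφ _ _ (List.Perm.swap a b l')
    simp only [coboundary, this]
    ring
  | trans _ _ ih₁ ih₂ => rw [ih₁ hφ, ih₂ hφ]

theorem prism_add (f g : X → Y) (φ ψ : List Y → ZMod 2) (l : List X) :
    prism f g (fun l => φ l + ψ l) l = prism f g φ l + prism f g ψ l := by
  induction l generalizing φ ψ with
  | nil => simp [prism]
  | cons a l ih => simp only [prism, ih]; ring

/-- Locality of the prism: it keeps cochain identities that hold only on small simplices usable. -/
theorem prism_congr {f g : X → Y} {φ ψ : List Y → ZMod 2} {l : List X}
    (h : ∀ l', l'.length = l.length + 1 → (∀ y ∈ l', ∃ x ∈ l, y = f x ∨ y = g x) → φ l' = ψ l') :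
    prism f g φ l = prism f g ψ l := by
  induction l generalizing φ ψ with
  | nil => rfl
  | cons a l ih =>
    simp only [prism]
    congr 1
    · refine h _ (by simp) fun y hy => ?_
      simp only [List.mem_cons, List.mem_map] at hy ⊢
      rcases hy with rfl | rfl | ⟨x, hx, rfl⟩
      · exact ⟨a, Or.inl rfl, Or.inl rfl⟩
      · exact ⟨a, Or.inl rfl, Or.inr rfl⟩
      · exact ⟨x, Or.inr hx, Or.inr rfl⟩
    · refine ih fun l' hl' hm => h _ (by simp [hl']) fun y hy => ?_
      rcases List.mem_cons.1 hy with rfl | hy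
      · exact ⟨a, by simp, Or.inl rfl⟩
      · obtain ⟨x, hx, hxy⟩ := hm y hy
        exact ⟨x, List.mem_cons_of_mem _ hx, hxy⟩

/-- The prism operator is a homotopy between the cochain maps induced by `f` and `g`. -/
theorem prism_coboundary (f g : X → Y) (φ : List Y → ZMod 2) (l : List X) :
    prism f g (coboundary φ) l =
      coboundary (prism f g φ) l + (φ (l.map f) + φ (l.map g)) := by
  induction l generalizing φ with
  | nil => simp [prism, coboundary, CharTwo.add_self_eq_zero]
  | cons a l ih =>
    simp only [prism, coboundary, List.map_cons]
    rw [prism_add, ih, coboundary_add, coboundary_map g fun l' => φ (f a :: g a :: l')]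
    have := CharTwo.add_self_eq_zero (φ (f a :: l.map g))
    linear_combination this

/-! ### Alternating sign sequences and Fan's cochain. -/

/-- The indicator function of the sign sequences that alternate, starting with the sign `b`. -/
def alternating : Bool → List Bool → ZMod 2
  | _, [] => 1
  | b, c :: l => if c = b then alternating (!b) l else 0

/-- A sequence with one repeated adjacent sign loses the repetition in two ways, which cancel. In a
nonempty alternating sequence, only deleting the last entry (start `b`) or the first (start `!b`)
counts. -/
theorem coboundary_alternating (b : Bool) (l : List Bool) :
    coboundary (alternating b) l = alternating b l + alternating (!b) l := by
  induction l generalizing b with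
  | nil => simp [coboundary, alternating, CharTwo.add_self_eq_zero]
  | cons c l ih =>
    simp only [coboundary, alternating]
    by_cases h : c = b
    · subst h
      have := CharTwo.add_self_eq_zero (alternating c l)
      simp only [if_true, ih, Bool.not_not, Bool.eq_not_self, if_false]
      linear_combination this
    · have h' : c = !b := by cases b <;> cases c <;> simp_all
      subst h'
      simp [coboundary_zero]

theorem alternating_map_not (b : Bool) (l : List Bool) :
    alternating b (l.map not) = alternating (!b) l := by
  induction l generalizing b with
  | nil => rfl
  | cons c l ih =>
    simp only [List.map_cons, alternating, ih]
    cases b <;> cases c <;> simp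

/-- The label `2 * k + 1` stands for `+k` and the label `2 * k` for `-k`. -/
def labelSign (a : ℕ) : Bool := decide (a % 2 = 1)

/-- The label opposite to `a`. -/
def labelNeg (a : ℕ) : ℕ := if a % 2 = 1 then a - 1 else a + 1

theorem labelSign_labelNeg (a : ℕ) : labelSign (labelNeg a) = !labelSign a := by
  unfold labelSign labelNeg
  split_ifs with h
  · have : ¬ (a - 1) % 2 = 1 := by omega
    simp [h, this]
  · have : (a + 1) % 2 = 1 := by omega
    simp [h, this]

/-- No two entries are opposite labels. -/
def NoOpposite (l : List ℕ) : Prop := ∀ a ∈ l, ∀ b ∈ l, b ≠ labelNeg a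

/-- The indicator function of Fan's positive alternating simplices. -/
def fanCochain (l : List ℕ) : ZMod 2 :=
  alternating true ((l.mergeSort (· ≤ ·)).map labelSign)

theorem mergeSort_eq_of_perm {l l' : List ℕ} (h : l.Perm l') (hs : l'.Pairwise (· ≤ ·)) :
    l.mergeSort (· ≤ ·) = l' :=
  List.Perm.eq_of_pairwise' (by simpa using List.pairwise_mergeSort' (· ≤ ·) l) hs
    ((List.mergeSort_perm l _).trans h)

theorem pairwise_mergeSort_le (l : List ℕ) : (l.mergeSort (· ≤ ·)).Pairwise (· ≤ ·) := by
  simpa using List.pairwise_mergeSort' (· ≤ ·) l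

theorem fanCochain_perm {l l' : List ℕ} (h : l.Perm l') : fanCochain l = fanCochain l' := by
  unfold fanCochain
  rw [mergeSort_eq_of_perm (h.trans (List.mergeSort_perm l' _).symm) (pairwise_mergeSort_le l')]

theorem fanCochain_of_pairwise {l : List ℕ} (hs : l.Pairwise (· ≤ ·)) :
    fanCochain l = alternating true (l.map labelSign) := by
  unfold fanCochain
  rw [mergeSort_eq_of_perm (List.Perm.refl l) hs]

/-- Negation only exchanges `2 * k` and `2 * k + 1`, so the order could break only between opposite
labels. -/
theorem pairwise_map_labelNeg {l : List ℕ} (hs : l.Pairwise (· ≤ ·)) (hl : NoOpposite l) :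
    (l.map labelNeg).Pairwise (· ≤ ·) := by
  rw [List.pairwise_map]
  refine hs.imp_of_mem fun {a b} ha hb hab => ?_
  have := hl a ha b hb
  unfold labelNeg at this ⊢
  split_ifs at this ⊢ <;> omega

theorem coboundary_fanCochain {l : List ℕ} (hl : NoOpposite l) :
    coboundary fanCochain l = fanCochain l + fanCochain (l.map labelNeg) := by
  set s := l.mergeSort (· ≤ ·) with hs
  have hp : s.Perm l := List.mergeSort_perm l _
  have hsort : s.Pairwise (· ≤ ·) := pairwise_mergeSort_le l
  have hsl : NoOpposite s := fun a ha b hb => hl a (hp.mem_iff.1 ha) b (hp.mem_iff.1 hb)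
  rw [← coboundary_perm (fun _ _ => fanCochain_perm) hp, ← fanCochain_perm hp,
    ← fanCochain_perm (hp.map labelNeg), fanCochain_of_pairwise hsort,
    fanCochain_of_pairwise (pairwise_map_labelNeg hsort hsl)]
  rw [coboundary_congr fun l' hl' => fanCochain_of_pairwise (hsort.sublist hl'),
    coboundary_map labelSign, coboundary_alternating, ← alternating_map_not, List.map_map,
    List.map_map]
  congr 3
  funext a
  simp [labelSign_labelNeg]

/-- Without opposite labels, each change of sign in a sorted list strictly raises the index `a / 2`;
only `n - m` indices are available. -/
theorem alternating_eq_zero_of_pairwise {n m : ℕ} {b : Bool} {l : List ℕ} (hmn : m ≤ n)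
    (hs : l.Pairwise (· ≤ ·)) (hl : NoOpposite l) (hn : ∀ a ∈ l, 2 * m ≤ a ∧ a < 2 * n)
    (hlen : n < l.length + m) :
    alternating b (l.map labelSign) = 0 := by
  induction l generalizing m b with
  | nil => simp only [List.length_nil] at hlen; omega
  | cons a l ih =>
    simp only [List.map_cons, alternating]
    split_ifs with hab
    swap
    · rfl
    have ha := hn a (by simp)
    cases l with
    | nil => simp only [List.length_cons, List.length_nil] at hlen; omega
    | cons c l =>
      by_cases hc : labelSign c = !b
      · have hac : a ≤ c := List.rel_of_pairwise_cons hs (by simp)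
        have hopp := hl a (by simp) c (by simp)
        have hcn := hn c (by simp)
        have hne : a ≠ c := by
          rintro rfl
          rw [hab] at hc
          cases b <;> simp at hc
        have hc2 : 2 * (m + 1) ≤ c := by
          unfold labelNeg at hopp
          split_ifs at hopp <;> omega
        refine ih (m := m + 1) (by omega) hs.of_cons
          (fun x hx y hy => hl x (List.mem_cons_of_mem _ hx) y (List.mem_cons_of_mem _ hy))
          (fun x hx => ⟨?_, (hn x (List.mem_cons_of_mem _ hx)).2⟩)
          (by simp only [List.length_cons] at hlen ⊢; omega)
        rcases List.mem_cons.1 hx with rfl | hx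
        · exact hc2
        · exact hc2.trans (List.rel_of_pairwise_cons hs.of_cons hx)
      · simp only [List.map_cons, alternating, if_neg hc]

theorem fanCochain_eq_zero {n : ℕ} {l : List ℕ} (hl : NoOpposite l) (hn : ∀ a ∈ l, a < 2 * n)
    (hlen : n < l.length) : fanCochain l = 0 := by
  have hp := List.mergeSort_perm l (· ≤ ·)
  exact alternating_eq_zero_of_pairwise (Nat.zero_le n) (pairwise_mergeSort_le l)
    (fun a ha b hb => hl a (hp.mem_iff.1 ha) b (hp.mem_iff.1 hb))
    (fun a ha => ⟨by omega, hn a (hp.mem_iff.1 ha)⟩) (by rw [hp.length_eq]; omega)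

/-! ### Hemispheres as iterated cones, and the Tucker–Fan lemma. -/

/-- The contraction `x ↦ (1 - t) x + t e_k`. -/
noncomputable def pull {D : ℕ} (k : ℕ) (t : ℝ) (x : Fin D → ℝ) : Fin D → ℝ :=
  fun i => (1 - t) * x i + t * if (i : ℕ) = k then 1 else 0

/-- The prism operator of the contraction to `e_k`, in `N` steps. -/
noncomputable def cone {D : ℕ} (N k : ℕ) (φ : List (Fin D → ℝ) → ZMod 2) :
    List (Fin D → ℝ) → ZMod 2 :=
  fun l => ∑ j ∈ Finset.range N, prism (pull k (j / N)) (pull k ((j + 1 : ℕ) / N)) φ l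

/-- Evaluation of a cochain on a fine triangulation of a `d`-dimensional hemisphere. -/
noncomputable def hemisphere {D : ℕ} (N : ℕ) : ℕ → (List (Fin D → ℝ) → ZMod 2) → ZMod 2
  | 0, φ => φ [fun i => if (i : ℕ) = 0 then 1 else 0]
  | d + 1, φ => hemisphere N d
      fun l => cone N (d + 1) φ l + cone N (d + 1) φ (l.map fun x => -x)

section

variable {D N : ℕ}

theorem pull_zero (k : ℕ) (x : Fin D → ℝ) : pull k 0 x = x := by
  funext i; simp [pull]

/-- The homotopy formulas of the N prisms telescope, leaving the ends t = 0 and t = 1. -/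
theorem cone_coboundary (hN : 0 < N) (k : ℕ) (φ : List (Fin D → ℝ) → ZMod 2)
    (l : List (Fin D → ℝ)) :
    cone N k (coboundary φ) l = coboundary (cone N k φ) l + (φ l + φ (l.map (pull k 1))) := by
  unfold cone
  rw [coboundary_sum]
  simp only [prism_coboundary, Finset.sum_add_distrib]
  rw [← Finset.sum_add_distrib]
  congr 1
  have key : ∀ M : ℕ, ∑ j ∈ Finset.range M, (φ (l.map (pull k ((j : ℕ) / N))) +
      φ (l.map (pull k ((j + 1 : ℕ) / N)))) = φ l + φ (l.map (pull k ((M : ℕ) / N))) := by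
    intro M
    induction M with
    | zero =>
      have : l.map (pull k ((0 : ℕ) / N : ℝ)) = l := by
        simp only [Nat.cast_zero, zero_div]
        rw [List.map_congr_left fun x _ => pull_zero k x, List.map_id']
      rw [this, Finset.sum_range_zero, CharTwo.add_self_eq_zero]
    | succ M ih =>
      rw [Finset.sum_range_succ, ih]
      have := CharTwo.add_self_eq_zero (φ (l.map (pull k ((M : ℕ) / N))))
      linear_combination this
  rw [key N, div_self (by positivity)]

theorem hemisphere_add (d : ℕ) (φ ψ : List (Fin D → ℝ) → ZMod 2) :
    hemisphere N d (fun l => φ l + ψ l) = hemisphere N d φ + hemisphere N d ψ := by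
  induction d generalizing φ ψ with
  | zero => rfl
  | succ d ih =>
    simp only [hemisphere]
    rw [← ih]
    congr 1
    funext l
    simp only [cone, prism_add, Finset.sum_add_distrib]
    ring

theorem hemisphere_zero (d : ℕ) :
    hemisphere N d (fun _ : List (Fin D → ℝ) => 0) = 0 := by
  have := hemisphere_add (N := N) d (fun _ : List (Fin D → ℝ) => 0) fun _ => 0
  simpa using this

/-- The boundary of a hemisphere consists of two antipodal hemispheres of one dimension less. -/
theorem hemisphere_coboundary (hN : 0 < N) (d : ℕ) (φ : List (Fin D → ℝ) → ZMod 2) :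
    hemisphere N (d + 1) (coboundary φ) =
      hemisphere N d fun l => φ l + φ (l.map fun x => -x) := by
  have hneg : ∀ l : List (Fin D → ℝ), (l.map fun x => -x).map (fun x => -x) = l := fun l => by
    simp [List.map_map]
  induction d generalizing φ with
  | zero =>
    simp only [hemisphere, cone_coboundary hN, List.map_cons, List.map_nil, coboundary]
    have h1 : ∀ x : Fin D → ℝ, pull 1 1 x = pull 1 1 (-x) := fun x => by
      funext i; simp [pull]
    rw [← h1]
    have h2 := CharTwo.add_self_eq_zero (cone N 1 φ [])
    have h3 := CharTwo.add_self_eq_zero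
      (φ [pull 1 1 (fun i : Fin D => if (i : ℕ) = 0 then (1 : ℝ) else 0)])
    simp only [zero_add] at *
    linear_combination h2 + h3
  | succ d ih =>
    rw [hemisphere]
    -- At t = 1 all points sit at the pole, so the terms from `l` and its antipode cancel.
    have h1 : ∀ l : List (Fin D → ℝ),
        (l.map fun x => -x).map (pull (d + 2) 1) = l.map (pull (d + 2) 1) := fun l => by
      rw [List.map_map]
      refine List.map_congr_left fun x _ => ?_
      funext i; simp [pull]
    have h2 : (fun l => cone N (d + 2) (coboundary φ) l +
          cone N (d + 2) (coboundary φ) (l.map fun x => -x)) =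
        fun l => coboundary (fun l => cone N (d + 2) φ l +
          cone N (d + 2) φ (l.map fun x => -x)) l + (φ l + φ (l.map fun x => -x)) := by
      funext l
      rw [cone_coboundary hN, cone_coboundary hN, h1, coboundary_add,
        coboundary_map (fun x => -x) (cone N (d + 2) φ)]
      have := CharTwo.add_self_eq_zero (φ (l.map (pull (d + 2) 1)))
      linear_combination this
    rw [h2, hemisphere_add, ih]
    -- The summed cone cochain is antipodally symmetric, so its contribution occurs twice.
    have h3 : (fun l : List (Fin D → ℝ) => (cone N (d + 2) φ l +
          cone N (d + 2) φ (l.map fun x => -x)) + (cone N (d + 2) φ (l.map fun x => -x) +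
          cone N (d + 2) φ ((l.map fun x => -x).map fun x => -x))) = fun _ => 0 := by
      funext l
      rw [hneg, add_comm (cone N (d + 2) φ (l.map fun x => -x)), CharTwo.add_self_eq_zero]
    rw [h3, hemisphere_zero, zero_add]

/-- A list of `d + 1` points that are close to each other on the `ℓ¹`-sphere of dimension `d`. -/
structure IsSmall (N d : ℕ) (l : List (Fin D → ℝ)) : Prop where
  length_eq : l.length = d + 1
  sum_abs : ∀ x ∈ l, ∑ i, |x i| = 1
  eq_zero : ∀ x ∈ l, ∀ i : Fin D, d < i → x i = 0
  abs_sub_le : ∀ x ∈ l, ∀ y ∈ l, ∀ i, |x i - y i| ≤ 2 * d / N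

theorem IsSmall.neg {d : ℕ} {l : List (Fin D → ℝ)} (h : IsSmall N d l) :
    IsSmall N d (l.map fun x => -x) := by
  refine ⟨by simpa using h.1, ?_, ?_, ?_⟩
  · intro x hx
    obtain ⟨y, hy, rfl⟩ := List.mem_map.1 hx
    simpa using h.2 y hy
  · intro x hx i hi
    obtain ⟨y, hy, rfl⟩ := List.mem_map.1 hx
    simpa using h.3 y hy i hi
  · intro x hx x' hx' i
    obtain ⟨y, hy, rfl⟩ := List.mem_map.1 hx
    obtain ⟨y', hy', rfl⟩ := List.mem_map.1 hx'
    have := h.4 y' hy' y hy i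
    simpa [neg_add_eq_sub] using this

/-- The reason for the ℓ¹ norm: `x` and the pole have disjoint supports, so straight segments
between them stay on the sphere. -/
theorem sum_abs_pull {d : ℕ} (hd : d + 1 < D) {t : ℝ} (h0 : 0 ≤ t) (h1 : t ≤ 1)
    {x : Fin D → ℝ} (hx : ∑ i, |x i| = 1) (hz : ∀ i : Fin D, d < i → x i = 0) :
    ∑ i, |pull (d + 1) t x i| = 1 := by
  have : ∀ i : Fin D, |pull (d + 1) t x i| =
      (1 - t) * |x i| + t * if i = ⟨d + 1, hd⟩ then 1 else 0 := by
    intro i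
    by_cases hi : i = ⟨d + 1, hd⟩
    · subst hi
      simp [pull, hz ⟨d + 1, hd⟩ (by simp), abs_of_nonneg h0]
    · have hi' : ¬ (i : ℕ) = d + 1 := fun h => hi (Fin.ext h)
      simp [pull, hi, hi', abs_mul, abs_of_nonneg (sub_nonneg.2 h1)]
  simp only [this, Finset.sum_add_distrib, ← Finset.mul_sum, hx]
  simp

theorem abs_pull_sub_pull_le {k : ℕ} {s t : ℝ} (h0 : 0 ≤ t) (h1 : t ≤ 1)
    {x y : Fin D → ℝ} (hy : ∑ i, |y i| = 1) (i : Fin D) :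
    |pull k t x i - pull k s y i| ≤ |x i - y i| + 2 * |t - s| := by
  have hyi : |y i| ≤ 1 := by
    rw [← hy]
    exact Finset.single_le_sum (f := fun i => |y i|) (fun _ _ => abs_nonneg _) (Finset.mem_univ i)
  have heq : pull k t x i - pull k s y i =
      (1 - t) * (x i - y i) + (t - s) * ((if (i : ℕ) = k then 1 else 0) - y i) := by
    simp only [pull]; ring
  rw [heq]
  refine (abs_add_le _ _).trans (add_le_add ?_ ?_)
  · rw [abs_mul, abs_of_nonneg (sub_nonneg.2 h1)]
    exact mul_le_of_le_one_left (abs_nonneg _) (by linarith)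
  · rw [abs_mul, mul_comm]
    refine mul_le_mul_of_nonneg_right ?_ (abs_nonneg _)
    refine (abs_sub _ _).trans ?_
    split_ifs <;> simp <;> linarith

theorem IsSmall.of_pull {d j : ℕ} (hd : d + 1 < D) (hj : j < N) {l l' : List (Fin D → ℝ)}
    (h : IsSmall N d l) (hlen : l'.length = l.length + 1)
    (hl' : ∀ y ∈ l', ∃ x ∈ l, y = pull (d + 1) (j / N) x ∨ y = pull (d + 1) ((j + 1 : ℕ) / N) x) :
    IsSmall N (d + 1) l' := by
  have hN : (0 : ℝ) < N := by exact_mod_cast (by omega : 0 < N)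
  have hj' : ((j : ℝ) + 1) ≤ N := by exact_mod_cast hj
  have hl : ∀ y ∈ l', ∃ x ∈ l, ∃ t : ℝ, 0 ≤ t ∧ t ≤ 1 ∧ j / N ≤ t ∧ t ≤ (j + 1) / N ∧
      y = pull (d + 1) t x := by
    intro y hy
    obtain ⟨x, hx, hxy | hxy⟩ := hl' y hy
    · exact ⟨x, hx, _, by positivity, (div_le_one hN).2 (by linarith), le_rfl, by gcongr; linarith,
        hxy⟩
    · push_cast at hxy
      exact ⟨x, hx, _, by positivity, (div_le_one hN).2 hj', by gcongr; linarith, le_rfl, hxy⟩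
  refine ⟨by rw [hlen, h.1], ?_, ?_, ?_⟩
  · intro y hy
    obtain ⟨x, hx, t, h0, h1, -, -, rfl⟩ := hl y hy
    exact sum_abs_pull hd h0 h1 (h.2 x hx) (h.3 x hx)
  · intro y hy i hi
    obtain ⟨x, hx, t, -, -, -, -, rfl⟩ := hl y hy
    have h1 : ¬ (i : ℕ) = d + 1 := by omega
    simp [pull, h.3 x hx i (by omega), h1]
  · intro y hy y' hy' i
    obtain ⟨x, hx, t, h0, h1, ht, ht', rfl⟩ := hl y hy
    obtain ⟨x', hx', t', -, -, hs, hs', rfl⟩ := hl y' hy'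
    refine (abs_pull_sub_pull_le h0 h1 (h.2 x' hx') i).trans ?_
    have h3 := h.4 x hx x' hx' i
    -- Both parameters lie in one step of length 1 / N, so each dimension adds 2 / N to the mesh.
    have h4 : |t - t'| ≤ 1 / N := by
      rw [add_div] at ht' hs'
      rw [abs_le]; constructor <;> linarith
    push_cast
    have h5 : (2 * ((d : ℝ) + 1) / N) = 2 * d / N + 2 * (1 / N) := by ring
    rw [h5]
    linarith

theorem hemisphere_congr {d : ℕ} (hd : d < D) {φ ψ : List (Fin D → ℝ) → ZMod 2}
    (h : ∀ l, IsSmall N d l → φ l = ψ l) : hemisphere N d φ = hemisphere N d ψ := by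
  induction d generalizing φ ψ with
  | zero =>
    refine h _ ⟨by simp, ?_, ?_, by simp⟩
    · intro x hx
      rw [List.mem_singleton.1 hx, Finset.sum_eq_single ⟨0, hd⟩] <;> simp [Fin.ext_iff]
    · intro x hx i hi
      rw [List.mem_singleton.1 hx]
      simp [hi.ne']
  | succ d ih =>
    rw [hemisphere, hemisphere]
    have hc : ∀ l, IsSmall N d l → cone N (d + 1) φ l = cone N (d + 1) ψ l := fun l hl =>
      Finset.sum_congr rfl fun j hj => prism_congr fun l' h1 h2 =>
        h l' (hl.of_pull hd (Finset.mem_range.1 hj) h1 h2)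
    refine ih (by omega) fun l hl => ?_
    rw [hc l hl, hc _ hl.neg]

/-- A form of the lemmas of Tucker and Fan: a symmetric labelling of the `d`-sphere with `n ≤ d`
pairs of labels has opposite labels on two points that are close to each other. -/
theorem exists_opposite_labels {n d : ℕ} (hnd : n ≤ d) (hd : d < D) (hN : 0 < N)
    (L : (Fin D → ℝ) → ℕ) (hL : ∀ x, ∑ i, |x i| = 1 → L x < 2 * n ∧ L (-x) = labelNeg (L x)) :
    ∃ x y : Fin D → ℝ, ∑ i, |x i| = 1 ∧ ∑ i, |y i| = 1 ∧ (∀ i, |x i - y i| ≤ 2 * d / N) ∧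
      L y = labelNeg (L x) := by
  by_contra! hcon
  set θ : List (Fin D → ℝ) → ZMod 2 := fun l => fanCochain (l.map L) with hθ
  have hno : ∀ e ≤ d, ∀ l, IsSmall N e l → NoOpposite (l.map L) := by
    intro e he l hl a ha b hb
    obtain ⟨x, hx, rfl⟩ := List.mem_map.1 ha
    obtain ⟨y, hy, rfl⟩ := List.mem_map.1 hb
    refine hcon x y (hl.2 x hx) (hl.2 y hy) fun i => (hl.4 x hx y hy i).trans ?_
    gcongr
  -- Symmetry of `L` turns the antipode into `labelNeg`, so Fan's identity applies.
  have hcob : ∀ e ≤ d, hemisphere N e (fun l => θ l + θ (l.map fun x => -x)) =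
      hemisphere N e (coboundary θ) := by
    intro e he
    refine hemisphere_congr (by omega) fun l hl => ?_
    rw [hθ, coboundary_map L, coboundary_fanCochain (hno e he l hl)]
    congr 1
    change fanCochain _ = _
    rw [List.map_map, List.map_map]
    congr 1
    exact List.map_congr_left fun x hx => (hL x (hl.2 x hx)).2
  -- In dimension 0 the value is `θ [] = 1`, the empty sequence being alternating.
  have hone : ∀ e ≤ d, hemisphere N e (coboundary θ) = 1 := by
    intro e
    induction e with
    | zero => intro _; simp [hemisphere, coboundary, hθ, fanCochain, alternating]
    | succ e ih => intro he; rw [hemisphere_coboundary hN, hcob e (by omega), ih (by omega)]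
  have hzero : ∀ l, IsSmall N d l → θ l = 0 := by
    intro l hl
    refine fanCochain_eq_zero (n := n) (hno d le_rfl l hl) ?_ (by simp [hl.1]; omega)
    intro a ha
    obtain ⟨x, hx, rfl⟩ := List.mem_map.1 ha
    exact (hL x (hl.2 x hx)).1
  have h1 := hone d le_rfl
  rw [← hcob d le_rfl, hemisphere_congr hd (ψ := fun _ => 0) fun l hl => by
    rw [hzero l hl, hzero _ hl.neg, add_zero], hemisphere_zero] at h1
  exact zero_ne_one h1

end

end ListCochain

/-! ### The Borsuk–Ulam theorem. -/

/-- Vectors in `ℝ^n` with a large coordinate can be labelled by the position and the sign of one of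
their large coordinates. -/
theorem exists_label {n : ℕ} {ε : ℝ} (hε : 0 < ε) : ∃ ℓ : (Fin n → ℝ) → ℕ,
    (∀ v, (∃ k, ε ≤ |v k|) → ℓ v < 2 * n ∧ ℓ (-v) = ListCochain.labelNeg (ℓ v)) ∧
    ∀ v w, (∃ k, ε ≤ |v k|) → (∃ k, ε ≤ |w k|) → ℓ w = ListCochain.labelNeg (ℓ v) →
      ∃ k, ε ≤ |v k - w k| := by
  have h1 : ∀ u : Fin n → ℝ, ∃ j : ℕ, (∃ k, ε ≤ u k) → ∃ k : Fin n, (k : ℕ) = j ∧ ε ≤ u k := by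
    intro u
    by_cases h : ∃ k, ε ≤ u k
    · obtain ⟨k, hk⟩ := h
      exact ⟨k, fun _ => ⟨k, rfl, hk⟩⟩
    · exact ⟨0, fun h' => absurd h' h⟩
  choose c hc using h1
  classical
  -- The position is chosen from the absolute values, so `v` and `-v` share it and get opposite
  -- labels.
  refine ⟨fun v => if ∃ k : Fin n, (k : ℕ) = c (fun i => |v i|) ∧ 0 < v k then
      2 * c (fun i => |v i|) + 1 else 2 * c (fun i => |v i|), ?_, ?_⟩
  · intro v hv
    obtain ⟨k, hk, hvk⟩ := hc (fun i => |v i|) hv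
    have hkn := k.2
    have h2 : ∀ w : Fin n → ℝ, (∃ k' : Fin n, (k' : ℕ) = c (fun i => |v i|) ∧ 0 < w k') ↔
        0 < w k := by
      intro w
      constructor
      · rintro ⟨k', hk', h⟩
        rwa [Fin.ext (hk'.trans hk.symm)] at h
      · exact fun h => ⟨k, hk, h⟩
    simp only [Pi.neg_apply, abs_neg, h2]
    rw [← hk]
    rcases lt_or_ge 0 (v k) with h | h
    · have h3 : ¬ 0 < -v k := by linarith
      rw [if_pos h, if_neg h3]
      unfold ListCochain.labelNeg
      split_ifs <;> omega
    · have h3 : 0 < -v k := by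
        rw [abs_of_nonpos h] at hvk
        linarith
      rw [if_neg (not_lt.2 h), if_pos h3]
      unfold ListCochain.labelNeg
      split_ifs <;> omega
  · intro v w hv hw hvw
    obtain ⟨k, hk, hvk⟩ := hc (fun i => |v i|) hv
    obtain ⟨k', hk', hwk⟩ := hc (fun i => |w i|) hw
    have h2 : ∀ u : Fin n → ℝ, ∀ k : Fin n, (k : ℕ) = c (fun i => |u i|) →
        ((∃ k' : Fin n, (k' : ℕ) = c (fun i => |u i|) ∧ 0 < u k') ↔ 0 < u k) := by
      intro u k hk
      constructor
      · rintro ⟨k', hk', h⟩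
        rwa [Fin.ext (hk'.trans hk.symm)] at h
      · exact fun h => ⟨k, hk, h⟩
    simp only [h2 v k hk, h2 w k' hk'] at hvw
    rw [← hk, ← hk'] at hvw
    have hkk : k' = k := by
      apply Fin.ext
      unfold ListCochain.labelNeg at hvw
      split_ifs at hvw <;> omega
    subst hkk
    refine ⟨k', ?_⟩
    rcases lt_or_ge 0 (v k') with h | h <;> rcases lt_or_ge 0 (w k') with h' | h'
    · simp only [if_pos h, if_pos h'] at hvw
      unfold ListCochain.labelNeg at hvw
      split_ifs at hvw <;> omega
    · rw [abs_of_pos h] at hvk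
      exact le_trans (by linarith) (le_abs_self _)
    · rw [abs_of_pos h'] at hwk
      exact le_trans (by linarith) (neg_le_abs _)
    · simp only [if_neg (not_lt.2 h), if_neg (not_lt.2 h')] at hvw
      unfold ListCochain.labelNeg at hvw
      split_ifs at hvw <;> omega

/-- **Borsuk–Ulam theorem**: an odd continuous map `𝕊^d → ℝ^n` with `n ≤ d` has a zero. -/
theorem borsuk_ulam {n d : ℕ} (hnd : n ≤ d)
    (f : Metric.sphere (0 : EuclideanSpace ℝ (Fin (d + 1))) 1 → Fin n → ℝ) (hf : Continuous f)
    (hodd : ∀ x, f (-x) = -f x) : ∃ x, f x = 0 := by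
  by_contra! hne
  -- The labelling lives on the ℓ¹-sphere; radial projection transports `f` there.
  set K : Set (Fin (d + 1) → ℝ) := {x | ∑ i, |x i| = 1} with hK
  have hnz : ∀ x ∈ K, WithLp.toLp 2 x ≠ (0 : EuclideanSpace ℝ (Fin (d + 1))) := by
    rintro x hx h0
    have : x = 0 := by simpa using h0
    simp [hK, this] at hx
  have hcK : IsCompact K := by
    refine Metric.isCompact_of_isClosed_isBounded
      (isClosed_eq (by fun_prop) continuous_const) ?_
    refine (Metric.isBounded_closedBall (x := (0 : Fin (d + 1) → ℝ)) (r := 1)).subset ?_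
    intro x hx
    rw [mem_closedBall_zero_iff, pi_norm_le_iff_of_nonneg zero_le_one]
    intro i
    rw [← show ∑ i, |x i| = 1 from hx]
    exact Finset.single_le_sum (f := fun i => |x i|) (fun _ _ => abs_nonneg _) (Finset.mem_univ i)
  let p : K → Metric.sphere (0 : EuclideanSpace ℝ (Fin (d + 1))) 1 := fun x =>
    ⟨‖WithLp.toLp 2 x.1‖⁻¹ • WithLp.toLp 2 x.1, by
      rw [mem_sphere_zero_iff_norm, norm_smul, norm_inv, norm_norm,
        inv_mul_cancel₀ (norm_ne_zero_iff.2 (hnz x x.2))]⟩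
  have hp : Continuous p := by
    refine Continuous.subtype_mk ?_ _
    have h1 : Continuous fun x : K => (WithLp.toLp 2 x.1 : EuclideanSpace ℝ (Fin (d + 1))) := by
      fun_prop
    exact (h1.norm.inv₀ fun x => norm_ne_zero_iff.2 (hnz x x.2)).smul h1
  have hKneg : ∀ x ∈ K, -x ∈ K := fun x hx => by simpa [hK] using hx
  have hpneg : ∀ x : K, p ⟨-x.1, hKneg x x.2⟩ = -p x := by
    intro x
    apply Subtype.ext
    simp [p]
  have : CompactSpace K := isCompact_iff_compactSpace.1 hcK
  set g : K → Fin n → ℝ := fun x => f (p x) with hg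
  have hgc : Continuous g := hf.comp hp
  have hK0 : Nonempty K := ⟨⟨Pi.single 0 1, by
    rw [hK, Set.mem_ofPred_eq, Finset.sum_eq_single 0] <;> simp +contextual⟩⟩
  obtain ⟨x₀, -, hx₀⟩ := isCompact_univ.exists_isMinOn Set.univ_nonempty hgc.norm.continuousOn
  set ε := ‖g x₀‖ with hε
  have hεpos : 0 < ε := norm_pos_iff.2 (hne _)
  have hex : ∀ x : K, ∃ k, ε ≤ |g x k| := by
    intro x
    by_contra! h
    exact absurd ((pi_norm_lt_iff hεpos).2 h) (not_lt.2 (hx₀ (Set.mem_univ x)))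
  obtain ⟨ℓ, hℓ, hℓ'⟩ := exists_label hεpos (n := n)
  obtain ⟨δ, hδ, hgδ⟩ := Metric.uniformContinuous_iff.1
    (CompactSpace.uniformContinuous_of_continuous hgc) ε hεpos
  obtain ⟨N, hN⟩ := exists_nat_gt (2 * d / δ)
  have hN0 : 0 < N := by
    have : (0 : ℝ) < N := lt_of_le_of_lt (by positivity) hN
    exact_mod_cast this
  classical
  set L : (Fin (d + 1) → ℝ) → ℕ := fun x => if h : x ∈ K then ℓ (g ⟨x, h⟩) else 0 with hL
  have hLK : ∀ x (h : x ∈ K), L x = ℓ (g ⟨x, h⟩) := fun x h => dif_pos h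
  obtain ⟨x, y, hx, hy, hxy, hopp⟩ := ListCochain.exists_opposite_labels hnd (Nat.lt_succ_self d)
    hN0 L fun x hx => by
      rw [hLK x hx, hLK (-x) (hKneg x hx)]
      have : g ⟨-x, hKneg x hx⟩ = -g ⟨x, hx⟩ := by
        rw [hg]
        change f (p ⟨-(⟨x, hx⟩ : K).1, _⟩) = _
        rw [hpneg, hodd]
      rw [this]
      exact hℓ _ (hex _)
  rw [hLK x hx, hLK y hy] at hopp
  obtain ⟨k, hk⟩ := hℓ' _ _ (hex _) (hex _) hopp
  have hdist : dist (⟨x, hx⟩ : K) ⟨y, hy⟩ < δ := by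
    rw [Subtype.dist_eq, dist_pi_lt_iff hδ]
    intro i
    rw [Real.dist_eq]
    refine (hxy i).trans_lt ?_
    rw [div_lt_iff₀ hδ] at hN
    rw [div_lt_iff₀ (by exact_mod_cast hN0)]
    linarith
  have := (dist_le_pi_dist (g ⟨x, hx⟩) (g ⟨y, hy⟩) k).trans_lt (hgδ hdist)
  rw [Real.dist_eq] at this
  linarith

/-! ### The median. -/

theorem Finset.card_univ_le_card_add_card {ι : Type*} [Fintype ι] [DecidableEq ι] {s t : Finset ι}
    (h : ∀ i, i ∈ s ∨ i ∈ t) : Fintype.card ι ≤ s.card + t.card := by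
  rw [← Finset.card_univ, ← Finset.eq_univ_iff_forall.2 fun i => Finset.mem_union.2 (h i)]
  exact Finset.card_union_le s t

/-- The median of `2 * q + 1` real numbers, as an odd continuous function. -/
theorem exists_median (q : ℕ) : ∃ med : (Fin (2 * q + 1) → ℝ) → ℝ,
    Continuous med ∧ (∀ z, med (-z) = -med z) ∧
    ∀ z, (Finset.univ.filter fun i => z i < med z).card ≤ q ∧
      (Finset.univ.filter fun i => med z < z i).card ≤ q := by
  have hex : ∀ z : Fin (2 * q + 1) → ℝ, ∃ m : ℝ,
      (Finset.univ.filter fun i => z i < m).card ≤ q ∧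
      (Finset.univ.filter fun i => m < z i).card ≤ q := by
    intro z
    have hmono := Tuple.monotone_sort z
    set σ := Tuple.sort z
    let c : Fin (2 * q + 1) := ⟨q, by omega⟩
    refine ⟨z (σ c), ?_, ?_⟩
    · calc _ ≤ ((Finset.Iio c).image σ).card := by
            refine Finset.card_le_card fun i hi => Finset.mem_image.2 ⟨σ.symm i, ?_, by simp⟩
            rw [Finset.mem_Iio]
            by_contra! h
            have := hmono h
            simp only [Function.comp, Equiv.apply_symm_apply] at this
            exact absurd (Finset.mem_filter.1 hi).2 (not_lt.2 this)
        _ ≤ (Finset.Iio c).card := Finset.card_image_le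
        _ ≤ q := by simp [c]
    · calc _ ≤ ((Finset.Ioi c).image σ).card := by
            refine Finset.card_le_card fun i hi => Finset.mem_image.2 ⟨σ.symm i, ?_, by simp⟩
            rw [Finset.mem_Ioi]
            by_contra! h
            have := hmono h
            simp only [Function.comp, Equiv.apply_symm_apply] at this
            exact absurd (Finset.mem_filter.1 hi).2 (not_lt.2 this)
        _ ≤ (Finset.Ioi c).card := Finset.card_image_le
        _ ≤ q := by simp [c]; omega
  -- Otherwise two sets of at most q indices would cover all 2q + 1. This yields the Lipschitz
  -- bound, and with ε = 0 uniqueness, hence oddness.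
  have key : ∀ (z z' : Fin (2 * q + 1) → ℝ) (m m' ε : ℝ),
      (Finset.univ.filter fun i => m < z i).card ≤ q →
      (Finset.univ.filter fun i => z' i < m').card ≤ q → (∀ i, z' i ≤ z i + ε) →
      m' ≤ m + ε := by
    intro z z' m m' ε h h' hz
    by_contra! hlt
    have := Finset.card_univ_le_card_add_card
      (s := Finset.univ.filter fun i => m < z i) (t := Finset.univ.filter fun i => z' i < m')
      fun i => by
        rcases lt_or_ge m (z i) with hi | hi
        · exact Or.inl (by simpa using hi)
        · exact Or.inr (by simpa using by linarith [hz i])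
    simp only [Fintype.card_fin] at this
    omega
  choose med h1 h2 using hex
  refine ⟨med, ?_, ?_, fun z => ⟨h1 z, h2 z⟩⟩
  · refine (LipschitzWith.of_le_add fun z' z => ?_ : LipschitzWith 1 med).continuous
    refine key z z' _ _ _ (h2 z) (h1 z') fun i => ?_
    have := (le_abs_self _).trans ((Real.dist_eq (z' i) (z i)).symm.le.trans (dist_le_pi_dist z' z i))
    linarith
  · intro z
    have h3 : (Finset.univ.filter fun i => (-z) i < -med z).card ≤ q := by
      simpa using h2 z
    have h4 : (Finset.univ.filter fun i => -med z < (-z) i).card ≤ q := by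
      simpa using h1 z
    have h5 := key (-z) (-z) _ _ 0 h4 (h1 (-z)) (by simp)
    have h6 := key (-z) (-z) _ _ 0 (h2 (-z)) h3 (by simp)
    linarith

/-! ### Maps to and from the box complex. -/

namespace SimpleGraph

variable {V : Type u} [Fintype V]

theorem adj_of_mem_body {G : SimpleGraph V} {a : V × Bool → ℝ} (ha : a ∈ G.boxComplex.body)
    {v w : V} (hv : 0 < a (v, true)) (hw : 0 < a (w, false)) : G.Adj v w := by
  obtain ⟨-, s, ⟨-, -, hs⟩, hsa⟩ := ha
  exact hs v ((hsa _).2 hv) w ((hsa _).2 hw)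

/-- An equivariant map to the box complex from the unnormalized coordinates at the positive
vertices. -/
theorem hasMap_boxSpace {G : SimpleGraph V} {S : Z2Space.{v}} (W : S.carrier → V → ℝ)
    (hW : Continuous W) (h0 : ∀ x v, 0 ≤ W x v)
    (hadj : ∀ x v w, 0 < W x v → 0 < W (S.inv x) w → G.Adj v w)
    (hex : ∀ x, ∃ v, 0 < W x v ∨ 0 < W (S.inv x) v) : S.HasMap G.boxSpace := by
  classical
  -- Negative weights are the positive weights at the opposite point, which forces equivariance.
  let a : S.carrier → V × Bool → ℝ := fun x p => if p.2 then W x p.1 else W (S.inv x) p.1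
  have ha0 : ∀ x p, 0 ≤ a x p := fun x p => by
    by_cases h : p.2 <;> simp [a, h, h0]
  have hac : Continuous a := by
    refine continuous_pi fun p => ?_
    by_cases h : p.2
    · simp only [a, h, if_true]
      exact (continuous_apply p.1).comp hW
    · simp only [a, h]
      exact (continuous_apply p.1).comp (hW.comp S.continuous_inv)
  have hsum : ∀ x, 0 < ∑ p, a x p := fun x => by
    obtain ⟨v, hv | hv⟩ := hex x
    · exact Finset.sum_pos' (fun p _ => ha0 x p) ⟨(v, true), Finset.mem_univ _, by simpa [a]⟩
    · exact Finset.sum_pos' (fun p _ => ha0 x p) ⟨(v, false), Finset.mem_univ _, by simpa [a]⟩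
  have hinv : ∀ x p, a (S.inv x) p = a x (signSwap p) := fun x p => by
    rcases p with ⟨v, b⟩
    cases b <;> simp [a, signSwap, S.involutive_inv x]
  have hsuminv : ∀ x, ∑ p, a (S.inv x) p = ∑ p, a x p := fun x => by
    simp only [hinv]
    exact Fintype.sum_equiv ⟨signSwap, signSwap, signSwap_signSwap, signSwap_signSwap⟩ _ _
      fun _ => rfl
  refine ⟨fun x => ⟨fun p => a x p / ∑ p, a x p, ⟨fun p => div_nonneg (ha0 x p) (hsum x).le, ?_⟩,
    Finset.univ.filter fun p => 0 < a x p, ⟨?_, ?_, ?_⟩, ?_⟩, ?_, ?_⟩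
  · rw [← Finset.sum_div, div_self (hsum x).ne']
  · by_contra h
    rw [Finset.not_nonempty_iff_eq_empty, Finset.filter_eq_empty_iff] at h
    exact absurd (hsum x) (not_lt.2 (Finset.sum_nonpos fun p hp => not_lt.1 (h hp)))
  · rw [Set.disjoint_left]
    intro v hv hv'
    simp only [plusPart, minusPart, Set.mem_ofPred_eq, Finset.mem_filter, Finset.mem_univ,
      true_and, a, if_true, Bool.false_eq_true, if_false] at hv hv'
    exact G.loopless.irrefl v (hadj x v v hv hv')
  · intro v hv w hw
    simp only [plusPart, minusPart, Set.mem_ofPred_eq, Finset.mem_filter, Finset.mem_univ,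
      true_and, a, if_true, Bool.false_eq_true, if_false] at hv hw
    exact hadj x v w hv hw
  · intro p
    simp [div_pos_iff_of_pos_right (hsum x)]
  · refine Continuous.subtype_mk (continuous_pi fun p => ?_) _
    refine ((continuous_apply p).comp hac).div
      (continuous_finsetSum _ fun p _ => (continuous_apply p).comp hac) fun x => (hsum x).ne'
  · intro x
    apply Subtype.ext
    funext p
    change a (S.inv x) p / _ = a x (signSwap p) / _
    rw [hinv, hsuminv]

theorem hasMap_sphere_zero_universalGraph : (Z2Space.sphere 0).HasMap (universalGraph 1 1).boxSpace := by
  refine hasMap_boxSpace (fun x _ => max (x.1 0) 0) ?_ (fun _ _ => le_max_right _ _) ?_ ?_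
  · refine continuous_pi fun _ => ?_
    have : Continuous fun x : Metric.sphere (0 : EuclideanSpace ℝ (Fin 1)) 1 => max (x.1 0) 0 := by
      fun_prop
    exact this
  · intro x v w h1 h2
    have h3 : 0 < x.1 0 := by simpa using h1
    have h4 : 0 < -x.1 0 := by
      change 0 < max (-x.1 0) 0 at h2
      simpa using h2
    linarith
  · intro x
    refine ⟨⟨(0, ∅), by simp⟩, ?_⟩
    have h : x.1 0 ≠ 0 := by
      intro h
      have h2 : x.1 = 0 := by
        ext i
        rw [Fin.fin_one_eq_zero i, h]
        rfl
      have h3 := mem_sphere_zero_iff_norm.1 x.2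
      simp [h2] at h3
    rcases h.lt_or_gt with h | h
    · right
      change 0 < max (-x.1 0) 0
      simpa using h
    · left
      simpa using h

/-- The lower bound for the coindex, from the median of the coordinates. -/
theorem hasMap_sphere_universalGraph (k : ℕ) :
    (Z2Space.sphere (2 * k + 1)).HasMap (universalGraph (2 * (k + 1) + 1) (k + 2)).boxSpace := by
  classical
  obtain ⟨med, hmedc, hmedneg, hmed⟩ := exists_median (k + 1)
  let X := Metric.sphere (0 : EuclideanSpace ℝ (Fin (2 * k + 1 + 1))) 1
  -- The appended 0 excludes constant vectors, so subtracting the median never gives 0.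
  let z : X → Fin (2 * (k + 1) + 1) → ℝ := fun x => Fin.snoc (α := fun _ => ℝ) (fun i => x.1 i) 0
  have hz : Continuous z := by
    refine Continuous.finSnoc ?_ continuous_const
    fun_prop
  have hzneg : ∀ x : X, z (-x) = -z x := fun x => by
    funext i
    refine Fin.lastCases ?_ (fun i => ?_) i
    · simp [z]
    · simp only [z, Fin.snoc_castSucc, Pi.neg_apply]
      rfl
  let y : X → Fin (2 * (k + 1) + 1) → ℝ := fun x i => z x i - med (z x)
  have hyc : Continuous y := by
    refine continuous_pi fun i => ?_
    exact ((continuous_apply i).comp hz).sub (hmedc.comp hz)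
  have hyneg : ∀ x : X, y (-x) = -y x := fun x => by
    funext i
    simp only [y, hzneg, hmedneg, Pi.neg_apply]
    ring
  have hy0 : ∀ x, y x ≠ 0 := by
    intro x h
    have h1 : ∀ i, z x i = med (z x) := fun i => sub_eq_zero.1 (congrFun h i)
    have h2 : med (z x) = 0 := by
      rw [← h1 (Fin.last _)]
      simp [z]
    have h3 : x.1 = 0 := by
      ext i
      have := h1 i.castSucc
      rw [h2] at this
      simpa [z] using this
    have h4 := mem_sphere_zero_iff_norm.1 x.2
    simp [h3] at h4
  have hcard : ∀ x, (Finset.univ.filter fun i => y x i < 0).card ≤ k + 1 := fun x => by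
    simpa [y, sub_neg] using (hmed (z x)).1
  let c : X → ℝ := fun x => ‖y x‖ / 2
  have hcneg : ∀ x, c (-x) = c x := fun x => by simp [c, hyneg]
  have hcpos : ∀ x, 0 < c x := fun x => half_pos (norm_pos_iff.2 (hy0 x))
  have hcc : Continuous c := hyc.norm.div_const 2
  -- The product vanishes unless `A` contains every `j` with `y x j ≤ -c x`.
  let W : X → UVertex (2 * (k + 1) + 1) (k + 2) → ℝ := fun x p =>
    max (y x p.1.1 - c x) 0 * ∏ j ∈ p.1.2ᶜ, max (y x j + c x) 0
  have hWpos : ∀ x p, 0 < W x p ↔ c x < y x p.1.1 ∧ ∀ j ∉ p.1.2, -c x < y x j := by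
    intro x p
    have hprod : 0 ≤ ∏ j ∈ p.1.2ᶜ, max (y x j + c x) 0 :=
      Finset.prod_nonneg fun _ _ => le_max_right _ _
    constructor
    · intro h
      have h1 := pos_of_mul_pos_left h hprod
      refine ⟨by simpa using h1, fun j hj => ?_⟩
      by_contra! hlt
      have : ∏ j ∈ p.1.2ᶜ, max (y x j + c x) 0 = 0 :=
        Finset.prod_eq_zero (Finset.mem_compl.2 hj) (max_eq_right (by linarith))
      simp [W, this] at h
    · rintro ⟨h1, h2⟩
      refine mul_pos (by simpa using h1) (Finset.prod_pos fun j hj => ?_)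
      exact lt_max_of_lt_left (by linarith [h2 j (Finset.mem_compl.1 hj)])
  have hmain : ∀ x, (∃ i, y x i = ‖y x‖) → ∃ p, 0 < W x p := by
    rintro x ⟨i, hi⟩
    have hsub : (Finset.univ.filter fun j => y x j < 0) ⊆ Finset.univ.erase i := by
      intro j hj
      refine Finset.mem_erase.2 ⟨?_, Finset.mem_univ j⟩
      rintro rfl
      have h1 := (Finset.mem_filter.1 hj).2
      rw [hi] at h1
      exact absurd h1 (not_lt.2 (norm_nonneg _))
    -- The at most k + 1 negative coordinates are padded to exactly r - 1 = k + 1 indices, avoiding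
    -- `i`.
    obtain ⟨A, hA, hAi, hAc⟩ := Finset.exists_subsuperset_card_eq hsub (hcard x)
      (by rw [Finset.card_erase_of_mem (Finset.mem_univ i), Finset.card_univ, Fintype.card_fin]; omega)
    refine ⟨⟨(i, A), by simp [hAc], fun h => by simpa using hAi h⟩, (hWpos _ _).2 ⟨?_, ?_⟩⟩
    · simp only [c]
      have := hcpos x
      simp only [c] at this
      linarith
    · intro j hj
      by_contra! h
      refine hj (hA (Finset.mem_filter.2 ⟨Finset.mem_univ j, ?_⟩))
      linarith [hcpos x]
  have hadj : ∀ x p q, 0 < W x p → 0 < W (-x) q →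
      (universalGraph (2 * (k + 1) + 1) (k + 2)).Adj p q := by
    intro x p q hp hq
    rw [hWpos] at hp hq
    simp only [hyneg, hcneg, Pi.neg_apply] at hq
    constructor
    · by_contra h
      linarith [hq.2 _ h]
    · by_contra h
      linarith [hp.2 _ h]
  have hex : ∀ x, ∃ p, 0 < W x p ∨ 0 < W (-x) p := by
    intro x
    obtain ⟨i, hi⟩ : ∃ i, ‖y x i‖ = ‖y x‖ := by
      obtain ⟨i, -, hi⟩ := Finset.exists_mem_eq_sup' (Finset.univ_nonempty) fun i => ‖y x i‖₊
      refine ⟨i, ?_⟩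
      rw [Pi.norm_def, ← Finset.sup'_eq_sup Finset.univ_nonempty, hi]
      rfl
    rcases abs_cases (y x i) with ⟨h, -⟩ | ⟨h, -⟩
    · obtain ⟨p, hp⟩ := hmain x ⟨i, by rw [← hi, Real.norm_eq_abs, h]⟩
      exact ⟨p, Or.inl hp⟩
    · obtain ⟨p, hp⟩ := hmain (-x) ⟨i, by
        rw [hyneg, norm_neg, ← hi, Real.norm_eq_abs, h, Pi.neg_apply]⟩
      exact ⟨p, Or.inr hp⟩
  refine hasMap_boxSpace (S := Z2Space.sphere (2 * k + 1)) W ?_ ?_ hadj hex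
  · refine continuous_pi fun p => ?_
    have hyi : ∀ i, Continuous fun x => y x i := fun i => (continuous_apply i).comp hyc
    exact (((hyi _).sub hcc).max continuous_const).mul
      (continuous_finsetProd _ fun j _ => ((hyi j).add hcc).max continuous_const)
  · exact fun x p => mul_nonneg (le_max_right _ _) (Finset.prod_nonneg fun _ _ => le_max_right _ _)

/-- The upper bound for the coindex. -/
theorem le_of_hasMap_sphere_universalGraph {k d : ℕ}
    (h : (Z2Space.sphere d).HasMap (universalGraph (2 * (k + 1) + 1) (k + 2)).boxSpace) :
    d ≤ 2 * k + 1 := by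
  classical
  by_contra! hd
  set G := universalGraph (2 * (k + 1) + 1) (k + 2)
  obtain ⟨f, hf, hodd⟩ := h
  let U : G.boxSpace.carrier → Fin (2 * (k + 1) + 1) → ℝ := fun a i =>
    ∑ v : UVertex (2 * (k + 1) + 1) (k + 2), if v.1.1 = i then a.1 (v, true) - a.1 (v, false) else 0
  have hUc : Continuous U := by
    refine continuous_pi fun i => continuous_finsetSum _ fun v _ => ?_
    split_ifs
    · exact ((continuous_apply (v, true)).comp continuous_subtype_val).sub
        ((continuous_apply (v, false)).comp continuous_subtype_val)
    · exact continuous_const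
  have hUneg : ∀ a, U (G.boxSpace.inv a) = -U a := by
    intro a
    funext i
    simp only [U, Pi.neg_apply, ← Finset.sum_neg_distrib]
    refine Finset.sum_congr rfl fun v _ => ?_
    have h1 : ∀ b, (G.boxSpace.inv a).1 (v, b) = a.1 (v, !b) := fun b => rfl
    split_ifs <;> simp [h1]
  have hnn : ∀ (a : G.boxSpace.carrier) p, 0 ≤ a.1 p := fun a p => a.2.1.1 p
  have hadj : ∀ (a : G.boxSpace.carrier) (v w : UVertex (2 * (k + 1) + 1) (k + 2)), 0 < a.1 (v, true) →
      0 < a.1 (w, false) → v.1.1 ∈ w.1.2 ∧ w.1.1 ∈ v.1.2 :=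
    fun a v w hv hw => adj_of_mem_body a.2 hv hw
  have hUpos : ∀ a i, 0 < U a i → ∃ v : UVertex (2 * (k + 1) + 1) (k + 2), v.1.1 = i ∧ 0 < a.1 (v, true) := by
    intro a i hi
    obtain ⟨v, -, hv⟩ := Finset.exists_lt_of_sum_lt (f := fun _ => (0 : ℝ)) (by simpa using hi)
    split_ifs at hv with h
    · exact ⟨v, h, by linarith [hnn a (v, false)]⟩
    · exact absurd hv (lt_irrefl _)
  have hne : ∀ a, ∃ i, U a i ≠ 0 := by
    -- No cancellation: vertices with equal first component are never adjacent, so they cannot carry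
    -- opposite signs.
    have key : ∀ a (v : UVertex (2 * (k + 1) + 1) (k + 2)), 0 < a.1 (v, true) → 0 < U a v.1.1 := by
      intro a v hv
      have h1 : ∀ w : UVertex (2 * (k + 1) + 1) (k + 2), w.1.1 = v.1.1 → a.1 (w, false) = 0 := by
        intro w hw
        by_contra h
        have := (hadj a v w hv (lt_of_le_of_ne (hnn a _) (Ne.symm h))).1
        exact w.2.2 (hw ▸ this)
      refine Finset.sum_pos' (fun w _ => ?_) ⟨v, Finset.mem_univ v, ?_⟩
      · split_ifs with hw
        · rw [h1 w hw, sub_zero]; exact hnn a _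
        · exact le_rfl
      · rw [if_pos rfl, h1 v rfl, sub_zero]; exact hv
    intro a
    obtain ⟨⟨v, b⟩, -, hv⟩ : ∃ p ∈ Finset.univ, 0 < a.1 p :=
      Finset.exists_lt_of_sum_lt (f := fun _ => (0 : ℝ)) (by simp [a.2.1.2])
    cases b
    · have := key (G.boxSpace.inv a) v hv
      rw [hUneg] at this
      exact ⟨v.1.1, fun h => by simp [h] at this⟩
    · exact ⟨v.1.1, (key a v hv).ne'⟩
  -- One negative vertex (j, B) suffices: every positive coordinate lies in `B`.
  have hU2 : ∀ a, (∃ i, U a i < 0) → (Finset.univ.filter fun i => 0 < U a i).card ≤ k + 1 := by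
    rintro a ⟨j, hj⟩
    obtain ⟨w, -, hw⟩ := hUpos (G.boxSpace.inv a) j (by rw [hUneg]; simpa using hj)
    have hw' : 0 < a.1 (w, false) := hw
    have : (Finset.univ.filter fun i => 0 < U a i) ⊆ w.1.2 := by
      intro i hi
      obtain ⟨v, rfl, hv⟩ := hUpos a i (Finset.mem_filter.1 hi).2
      exact (hadj a v w hv hw').1
    have h2 := w.2.1
    have h3 := Finset.card_le_card this
    omega
  -- Extended by a last entry 1, `s` has k + 2 positive and k + 1 negative entries, one positive too
  -- many for `hU2`; `g` is `U` modulo the line it spans.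
  let s : Fin (2 * (k + 1)) → ℝ := fun i => if (i : ℕ) < k + 1 then 1 else -1
  let g : G.boxSpace.carrier → Fin (2 * (k + 1)) → ℝ := fun a i =>
    U a i.castSucc - s i * U a (Fin.last _)
  have hlast : ∀ a, g a = 0 → ¬ 0 < U a (Fin.last _) := by
    intro a ha hpos
    have h1 : ∀ i : Fin (2 * (k + 1)), U a i.castSucc = s i * U a (Fin.last _) := fun i =>
      sub_eq_zero.1 (congrFun ha i)
    have h2 := hU2 a ⟨Fin.castSucc ⟨k + 1, by omega⟩, by
      rw [h1]; simpa [s] using hpos⟩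
    have h3 : (insert (Fin.last _) ((Finset.univ.filter fun i : Fin (2 * (k + 1)) =>
        (i : ℕ) < k + 1).map Fin.castSuccEmb)) ⊆ Finset.univ.filter fun i => 0 < U a i := by
      intro i hi
      rw [Finset.mem_filter]
      refine ⟨Finset.mem_univ i, ?_⟩
      rcases Finset.mem_insert.1 hi with rfl | hi
      · exact hpos
      · obtain ⟨j, hj, rfl⟩ := Finset.mem_map.1 hi
        have hj' := (Finset.mem_filter.1 hj).2
        rw [Fin.coe_castSuccEmb, h1]
        simpa only [s, if_pos hj', one_mul] using hpos
    have h4 := Finset.card_le_card h3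
    rw [Finset.card_insert_of_notMem (by simp [Fin.castSucc_ne_last]), Finset.card_map,
      Fin.card_filter_val_lt, min_eq_right (by omega)] at h4
    omega
  have hgneg : ∀ a, g (G.boxSpace.inv a) = -g a := by
    intro a
    funext i
    simp only [g, hUneg, Pi.neg_apply]
    ring
  have hgc : Continuous g := by
    refine continuous_pi fun i => ?_
    exact ((continuous_apply _).comp hUc).sub
      (continuous_const.mul ((continuous_apply _).comp hUc))
  obtain ⟨x, hx⟩ := borsuk_ulam (n := 2 * (k + 1)) (d := d) (by omega) (fun x => g (f x))
    (hgc.comp hf) fun x => by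
      exact (congrArg g (hodd x)).trans (hgneg (f x))
  have hx0 : g (f x) = 0 := hx
  have h1 := hlast _ hx0
  have h2 := hlast (G.boxSpace.inv (f x)) (by rw [hgneg, hx0, neg_zero])
  rw [hUneg, Pi.neg_apply] at h2
  have h3 : U (f x) (Fin.last _) = 0 := by linarith
  obtain ⟨i, hi⟩ := hne (f x)
  refine hi (Fin.lastCases h3 (fun i => ?_) i)
  have := congrFun hx0 i
  simp only [g, h3, mul_zero, sub_zero] at this
  exact this

theorem coind_universalGraph (k : ℕ) :
    (universalGraph (2 * (k + 1) + 1) (k + 2)).boxSpace.coind = ((2 * k + 1 : ℕ) : WithBot ℕ∞) := by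
  refine le_antisymm (iSup_le fun d => ?_) ?_
  · exact_mod_cast le_of_hasMap_sphere_universalGraph d.2
  · exact le_iSup (fun d : {d : ℕ // Z2Space.HasMap (Z2Space.sphere d) _} =>
      ((d : ℕ) : WithBot ℕ∞)) ⟨_, hasMap_sphere_universalGraph k⟩

end SimpleGraph

theorem mainTheorem4 (r : ℕ) (hr : 1 ≤ r) :
    (SimpleGraph.universalGraph (2 * r - 1) r).IsTopologicallyChromatic (2 * r - 2) ∧
      (2 ≤ r → (SimpleGraph.universalGraph (2 * r - 1) r).boxSpace.coind =
        ((2 * r - 3 : ℕ) : WithBot ℕ∞)) := by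
  rcases r with _ | _ | k
  · omega
  · refine ⟨?_, fun h => by omega⟩
    -- Even t = 0 needs a map from a sphere, since `⊥ + 1 = ⊥` in `WithBot ℕ∞`.
    have h : (0 : WithBot ℕ∞) ≤ (SimpleGraph.universalGraph 1 1).boxSpace.coind :=
      le_iSup (fun d : {d : ℕ // Z2Space.HasMap (Z2Space.sphere d) _} =>
        ((d : ℕ) : WithBot ℕ∞)) ⟨0, SimpleGraph.hasMap_sphere_zero_universalGraph⟩
    exact h.trans (le_add_of_nonneg_right zero_le_one)
  · have h := SimpleGraph.coind_universalGraph k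
    refine ⟨?_, fun _ => h⟩
    change ((2 * k + 2 : ℕ) : WithBot ℕ∞) ≤
      (SimpleGraph.universalGraph (2 * (k + 1) + 1) (k + 2)).boxSpace.coind + 1
    rw [h]
    exact_mod_cast le_rfl
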